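/- Let $\lambda_b,\lambda_u,\lambda_l,\mu_b>0$. On a stationary framework $(\Omega,\mathcal A,\mathbf P,\{\theta_t\}_{t\in\mathbb R^2})$ (a probability space with a measurable flow preserving $\mathbf P$), let $\Phi_b$ (planar base stations) and $\Phi_u$ (planar users) be homogeneous Poisson point processes on $\mathbb R^2$ with intensities $\lambda_b$ and $\lambda_u$. Let $\Xi$ be a Poisson point process on $\mathbb R\times[0,\pi)$ with intensity measure $\frac{\lambda_l}{\pi}\,dr\,d\theta$; its points $(r_i,\theta_i)$ define the lines (roads) $\{(x,y): x\cos\theta_i+y\sin\theta_i=r_i\}$. Conditionally on the lines, place on each line an independent one-dimensional homogeneous Poisson point process with intensity $\mu_b$ (with respect to arc length), and let $\Psi_b$ (vehicular base stations) be the union of these processes. Assume that $\Phi_b$, $\Phi_u$ and the road system with its vehicular base stations are mutually independent, and that $\Phi_b,\Phi_u,\Psi_b$ are compatible with the flow $\{\theta_t\}$ (jointly stationary). Let $\mathbf P^0_{\Phi_u}$ be the Palm probability with respect to $\Phi_u$, and let $X_\star$ be a base station closest to the origin, i.e. $X_\star\in\arg\min_{X\in\Phi_b\cup\Psi_b}\|X\|$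 whenever $\Phi_b\cup\Psi_b$ is non-empty (ties may be broken arbitrarily). Then the integrals below converge and $$\mathbf P^0_{\Phi_u}(X_\star\in\Phi_b)=\int_0^\infty 2\pi\lambda_b r\exp\Big(-\pi\lambda_b r^2-2\lambda_l\int_0^r\big(1-e^{-2\mu_b\sqrt{r^2-t^2}}\big)\,dt\Big)\,dr,$$ $$\mathbf P^0_{\Phi_u}(X_\star\in\Psi_b)=1-\int_0^\infty 2\pi\lambda_b r\exp\Big(-\pi\lambda_b r^2-2\lambda_l\int_0^r\big(1-e^{-2\mu_b\sqrt{r^2-t^2}}\big)\,dt\Big)\,dr.$$ -/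

import Mathlib

open MeasureTheory ProbabilityTheory Set
open scoped ENNReal

namespace CoxNetwork

/-- The Euclidean plane. -/
abbrev Plane := EuclideanSpace ℝ (Fin 2)

/-- A (simple) point configuration: a set of points with finitely many points in every
compact set. -/
structure Configuration (E : Type*) [TopologicalSpace E] where
  /-- the set of points -/
  pts : Set E
  locallyFinite : ∀ K : Set E, IsCompact K → (pts ∩ K).Finite

/-- The number of points of a configuration in a set. -/
noncomputable def Configuration.count {E : Type*} [TopologicalSpace E]
    (s : Configuration E) (B : Set E) : ℕ∞ := (s.pts ∩ B).encard

/-- The sigma-algebra on configurations generated by the numbers of points in measurable sets. -/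
noncomputable instance instMeasurableSpaceConfiguration {E : Type*} [TopologicalSpace E] [MeasurableSpace E] :
    MeasurableSpace (Configuration E) :=
  ⨆ B : {B : Set E // MeasurableSet B},
    MeasurableSpace.comap (fun s : Configuration E => s.count B.1) inferInstance

/-- `N` is a Poisson point process with intensity measure `Λ`: the number of points in a set of
finite intensity is Poisson distributed, and the numbers of points in disjoint sets are
independent. -/
structure IsPoissonProcess {Ω E : Type*} [MeasurableSpace Ω] [TopologicalSpace E]
    [MeasurableSpace E] (P : Measure Ω) (N : Ω → Configuration E) (Λ : Measure E) : Prop where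
  measurable : Measurable N
  law : ∀ B : Set E, MeasurableSet B → Λ B ≠ ∞ → ∀ k : ℕ,
    P {ω | (N ω).count B = k} = poissonMeasure (Λ B).toNNReal {k}
  indep : ∀ (n : ℕ) (B : Fin n → Set E), (∀ i, MeasurableSet (B i)) →
    Pairwise (fun i j => Disjoint (B i) (B j)) →
    iIndepFun (fun i ω => (N ω).count (B i)) P

/-- The parameter space `ℝ × [0, π)` of undirected lines of the plane. -/
def cylinder : Set (ℝ × ℝ) := univ ×ˢ Ico 0 Real.pi

/-- The line `x cos θ + y sin θ = r`, with `p = (r, θ)`. -/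
def roadLine (p : ℝ × ℝ) : Set Plane :=
  {z | z 0 * Real.cos p.2 + z 1 * Real.sin p.2 = p.1}

/-- The arc length parametrization of the line `x cos θ + y sin θ = r`, with `p = (r, θ)`, that
starts at the point of the line closest to the origin. -/
noncomputable def roadPoint (p : ℝ × ℝ) (t : ℝ) : Plane :=
  !₂[p.1 * Real.cos p.2 - t * Real.sin p.2, p.1 * Real.sin p.2 + t * Real.cos p.2]

theorem range_roadPoint (p : ℝ × ℝ) : range (roadPoint p) = roadLine p := by
  have h := Real.sin_sq_add_cos_sq p.2
  ext z
  constructor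
  · rintro ⟨t, rfl⟩
    simp only [roadLine, roadPoint, mem_ofPred_eq, Matrix.cons_val_zero,
      Matrix.cons_val_one]
    linear_combination p.1 * h
  · intro hz
    simp only [roadLine, mem_ofPred_eq] at hz
    refine ⟨z 1 * Real.cos p.2 - z 0 * Real.sin p.2, ?_⟩
    ext i
    fin_cases i
    · simp only [roadPoint, Fin.zero_eta, PiLp.toLp_apply, Matrix.cons_val_zero]
      rw [← hz]
      linear_combination z 0 * h
    · simp only [roadPoint, Fin.mk_one, PiLp.toLp_apply, Matrix.cons_val_one]
      rw [← hz]
      simp only [Matrix.cons_val_fin_one]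
      linear_combination z 1 * h

theorem dist_roadPoint (p : ℝ × ℝ) (s t : ℝ) :
    dist (roadPoint p s) (roadPoint p t) = |s - t| := by
  have h := Real.sin_sq_add_cos_sq p.2
  rw [EuclideanSpace.dist_eq, Fin.sum_univ_two, ← Real.sqrt_sq_eq_abs]
  congr 1
  simp only [roadPoint, PiLp.toLp_apply, Matrix.cons_val_zero, Matrix.cons_val_one,
    Matrix.cons_val_fin_one, Real.dist_eq, sq_abs]
  linear_combination (s - t) ^ 2 * h

/-- A stationary framework: a measurable flow indexed by the plane that preserves the
probability measure. -/
structure IsStationaryFramework {Ω : Type*} [MeasurableSpace Ω] (P : Measure Ω)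
    (flow : Plane → Ω → Ω) : Prop where
  measurable : Measurable (fun q : Plane × Ω => flow q.1 q.2)
  zero : ∀ ω, flow 0 ω = ω
  add : ∀ s t ω, flow (s + t) ω = flow s (flow t ω)
  measurePreserving : ∀ t, MeasurePreserving (flow t) P P

/-- `N` is compatible with the flow: applying `flow t` moves each point `x` of `N` to `x - t`. -/
def IsCompatible {Ω : Type*} (flow : Plane → Ω → Ω) (N : Ω → Configuration Plane) : Prop :=
  ∀ t ω, (N (flow t ω)).pts = {x | x + t ∈ (N ω).pts}

/-- The unit square `[0, 1)²`. -/
def unitSquare : Set Plane := {x | ∀ i, x i ∈ Ico (0 : ℝ) 1}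

/-- The intensity of a stationary point process: its mean number of points per unit area. -/
noncomputable def intensity {Ω : Type*} [MeasurableSpace Ω] (P : Measure Ω)
    (N : Ω → Configuration Plane) : ℝ≥0∞ :=
  ∫⁻ ω, ((N ω).count unitSquare : ℝ≥0∞) ∂P

/-- The Palm probability of an event `A` with respect to the point process `N`: the mean number
of points `x` of `N` in the unit square from which `A` is observed, that is `flow x ω ∈ A`,
divided by the intensity of `N`. -/
noncomputable def palm {Ω : Type*} [MeasurableSpace Ω] (P : Measure Ω)
    (flow : Plane → Ω → Ω) (N : Ω → Configuration Plane) (A : Set Ω) : ℝ≥0∞ :=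
  (∫⁻ ω, ∑' x : ↥((N ω).pts ∩ unitSquare), A.indicator 1 (flow x ω) ∂P) / intensity P N

/-- The network model. `Φb`, `Φu` are the planar base stations and the planar users, `Ξ` is the
process of line parameters (the roads), `L` is a numbering of the points of `Ξ`, `φ i` is the
process of positions of the base stations along the `i`-th road, and `Ψb` is the Cox process of
the vehicular base stations. -/
structure IsNetwork {Ω : Type*} [MeasurableSpace Ω] (P : Measure Ω) (flow : Plane → Ω → Ω)
    (lamb lamu laml mub : ℝ) (Φb Φu : Ω → Configuration Plane)
    (Ξ : Ω → Configuration (ℝ × ℝ)) (L : ℕ → Ω → ℝ × ℝ) (φ : ℕ → Ω → Configuration ℝ)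
    (Ψb : Ω → Configuration Plane) : Prop where
  /-- planar base stations and planar users: homogeneous Poisson -/
  poisson_Φb : IsPoissonProcess P Φb (ENNReal.ofReal lamb • volume)
  poisson_Φu : IsPoissonProcess P Φu (ENNReal.ofReal lamu • volume)
  /-- the roads: a Poisson line process -/
  poisson_Ξ : IsPoissonProcess P Ξ (ENNReal.ofReal (laml / Real.pi) • volume.restrict cylinder)
  /-- the numbering of the roads -/
  measurable_L : ∀ i, Measurable (L i)
  mem_cylinder : ∀ i ω, L i ω ∈ cylinder
  injective_L : ∀ ω, Function.Injective (fun i => L i ω)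
  range_L : ∀ ω, range (fun i => L i ω) = (Ξ ω).pts
  /-- independent copies of a one-dimensional Poisson process, one for each road -/
  poisson_φ : ∀ i, IsPoissonProcess P (φ i) (ENNReal.ofReal mub • volume)
  iIndep_φ : iIndepFun φ P
  indep_L_φ : IndepFun (fun ω i => L i ω) (fun ω i => φ i ω) P
  /-- vehicular base stations: the copies placed on the roads -/
  measurable_Ψb : Measurable Ψb
  pts_Ψb : ∀ ω, (Ψb ω).pts = ⋃ i, roadPoint (L i ω) '' (φ i ω).pts
  /-- planar base stations, planar users and the road system are independent -/
  indep_Φb : IndepFun Φb (fun ω => ((fun i => L i ω), (fun i => φ i ω))) P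
  indep_Φu : IndepFun Φu (fun ω => (Φb ω, (fun i => L i ω), (fun i => φ i ω))) P
  /-- joint stationarity -/
  stationary : IsStationaryFramework P flow
  compatible_Φb : IsCompatible flow Φb
  compatible_Φu : IsCompatible flow Φu
  compatible_Ψb : IsCompatible flow Ψb

/-- `x` is a point of `S` closest to the origin. -/
def IsNearest (S : Set Plane) (x : Plane) : Prop := x ∈ S ∧ ∀ y ∈ S, ‖x‖ ≤ ‖y‖

/-- The integrand of the probability of association with a planar base station. -/
noncomputable def associationDensity (lamb laml mub r : ℝ) : ℝ :=
  2 * Real.pi * lamb * r * Real.exp (-Real.pi * lamb * r ^ 2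
    - 2 * laml * ∫ t in (0 : ℝ)..r, (1 - Real.exp (-2 * mub * √(r ^ 2 - t ^ 2))))

end CoxNetwork

/-! Let `Rb` and `Rv` be the distances from the origin to the planar and to the vehicular base
stations, infinite if there are none. The nearest station is planar exactly when `Rb < Rv`, up to
ties. Seen from a typical user these distances have their stationary law: the users are independent
of all stations, so Campbell's formula and invariance under the flow cancel the user intensity
(`palm_infEDist`). The void probability of a disc makes `Rb` a Rayleigh variable
(`map_infEDist_eq_rayleigh`). For `Rv`, condition on the roads: a road at distance `ρ < r` meets the
disc of radius `r` in a chord of length `2√(r² - ρ²)`, so the disc is empty with probability the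
exponential of minus `mub` times the total chord length. The Laplace functional of the line process
averages this over the roads (`measure_le_roadDist`). As `Rb` and `Rv` are independent, `P(Rb ≤ Rv)`
integrates the tail of `Rv` against the density of `Rb`. Ties are null because `Rb` has no atoms,
and the second probability is the complement. `Xstar` need not be measurable, so its events are
enclosed between the strict and the weak comparison of `Rb` and `Rv`. -/

namespace CoxNetwork

/-! ### The exponential of minus an extended nonnegative number. -/

section ExpNeg

/-- The decreasing exponential `x ↦ exp (-x)` on `[0, ∞]`. -/
noncomputable def expNeg (x : ℝ≥0∞) : ℝ≥0∞ := EReal.exp (-(x : EReal))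

theorem expNeg_ofReal {x : ℝ} (hx : 0 ≤ x) :
    expNeg (ENNReal.ofReal x) = ENNReal.ofReal (Real.exp (-x)) := by
  rw [expNeg, EReal.coe_ennreal_ofReal, max_eq_left hx, ← EReal.coe_neg, EReal.exp_coe]

@[simp] theorem expNeg_zero : expNeg 0 = 1 := by simp [expNeg]

theorem expNeg_add (x y : ℝ≥0∞) : expNeg (x + y) = expNeg x * expNeg y := by
  rw [expNeg, EReal.coe_ennreal_add, EReal.neg_add (by simp) (by simp), sub_eq_add_neg,
    EReal.exp_add]
  rfl

theorem expNeg_sum {ι : Type*} (s : Finset ι) (f : ι → ℝ≥0∞) :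
    expNeg (∑ i ∈ s, f i) = ∏ i ∈ s, expNeg (f i) := by
  classical
  induction s using Finset.induction_on with
  | empty => simp
  | insert a s ha ih => rw [Finset.sum_insert ha, Finset.prod_insert ha, expNeg_add, ih]

/-- Continuity includes the point `∞`, where the value is `0`; limits of sums and integrals then
pass through `expNeg` without any finiteness check. -/
theorem continuous_expNeg : Continuous expNeg :=
  ENNReal.continuous_exp.comp (continuous_neg.comp continuous_coe_ennreal_ereal)

theorem antitone_expNeg : Antitone expNeg := fun _ _ h =>
  EReal.exp_monotone (EReal.neg_le_neg_iff.2 (EReal.coe_ennreal_le_coe_ennreal_iff.2 h))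

theorem expNeg_le_one (x : ℝ≥0∞) : expNeg x ≤ 1 := by
  simpa using antitone_expNeg (zero_le (a := x))

@[fun_prop] theorem measurable_expNeg : Measurable expNeg := continuous_expNeg.measurable

end ExpNeg

/-! ### Configurations as counting measures, and measurability of functionals of their points. -/

namespace Configuration

section

variable {E : Type*} [TopologicalSpace E] [MeasurableSpace E]

theorem measurable_count {B : Set E} (hB : MeasurableSet B) :
    Measurable (fun s : Configuration E => s.count B) :=
  Measurable.of_comap_le (le_iSup (fun B : {B : Set E // MeasurableSet B} =>
    MeasurableSpace.comap (fun s : Configuration E => s.count B.1) inferInstance) ⟨B, hB⟩)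

/-- The counting measure of a configuration. -/
noncomputable def measure (s : Configuration E) : Measure E := Measure.count.restrict s.pts

theorem measure_ne_zero_iff (s : Configuration E) {B : Set E} (hB : MeasurableSet B) :
    s.measure B ≠ 0 ↔ ∃ x ∈ s.pts, x ∈ B := by
  rw [measure, Measure.restrict_apply hB, Measure.count_ne_zero_iff]
  exact ⟨fun ⟨x, h1, h2⟩ => ⟨x, h2, h1⟩, fun ⟨x, h1, h2⟩ => ⟨x, h2, h1⟩⟩

end

variable {E : Type*} [TopologicalSpace E] [SigmaCompactSpace E]

theorem countable_pts (s : Configuration E) : s.pts.Countable := by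
  have h : s.pts = ⋃ n, s.pts ∩ compactCovering E n := by
    rw [← inter_iUnion, iUnion_compactCovering, inter_univ]
  rw [h]
  exact countable_iUnion fun n => (s.locallyFinite _ (isCompact_compactCovering E n)).countable

variable [MeasurableSpace E]

variable [T2Space E] [BorelSpace E]

theorem measure_apply (s : Configuration E) {B : Set E} (hB : MeasurableSet B) :
    s.measure B = (s.count B : ℝ≥0∞) := by
  rw [measure, Measure.restrict_apply hB,
    Measure.count_apply (hB.inter s.countable_pts.measurableSet), count, inter_comm]

theorem lintegral_measure (s : Configuration E) (f : E → ℝ≥0∞) :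
    ∫⁻ x, f x ∂s.measure = ∑' x : s.pts, f x := by
  rw [measure, lintegral_countable f s.countable_pts]
  simp

/-- The kernel that sends a configuration to its counting measure. -/
noncomputable def kernel (E : Type*) [TopologicalSpace E] [SigmaCompactSpace E]
    [MeasurableSpace E] [T2Space E] [BorelSpace E] : Kernel (Configuration E) E where
  toFun := measure
  measurable' := Measure.measurable_of_measurable_coe _ fun B hB => by
    simp_rw [fun s : Configuration E => s.measure_apply hB]
    exact (Measurable.of_discrete (f := fun n : ℕ∞ => (n : ℝ≥0∞))).comp (measurable_count hB)

theorem kernel_apply (s : Configuration E) : kernel E s = s.measure := rfl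

theorem measurableSet_compactCovering (n : ℕ) : MeasurableSet (compactCovering E n) :=
  (isCompact_compactCovering E n).isClosed.measurableSet

/-- The number of points in a compact set is finite but not uniformly bounded over configurations.
The kernel is therefore cut both by the pieces `D n` of space and by the number `k` of points in the
piece; each part has mass at most `k`. -/
instance : IsSFiniteKernel (kernel E) := by
  classical
  set D : ℕ → Set E := disjointed (compactCovering E) with hD
  have hDm (n) : MeasurableSet (D n) :=
    MeasurableSet.disjointed (fun i => measurableSet_compactCovering i) n
  have hS (n k : ℕ) : MeasurableSet {s : Configuration E | s.count (D n) = k} :=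
    measurable_count (hDm n) (measurableSet_singleton _)
  let κ : ℕ × ℕ → Kernel (Configuration E) E := fun p =>
    Kernel.piecewise (hS p.1 p.2) ((kernel E).restrict (hDm p.1)) 0
  have hfin (p : ℕ × ℕ) : IsFiniteKernel (κ p) := by
    refine ⟨p.2, by simp, fun s => ?_⟩
    simp only [κ, Kernel.piecewise_apply]
    split_ifs with h
    · rw [Kernel.restrict_apply, Measure.restrict_apply_univ, kernel_apply,
        measure_apply _ (hDm _)]
      simp only [mem_ofPred_eq] at h
      rw [h]; simp
    · simp
  have heq : kernel E = Kernel.sum κ := by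
    ext s B hB
    rw [Kernel.sum_apply' _ _ hB, ENNReal.tsum_prod']
    have hn (n : ℕ) : ∑' k, κ (n, k) s B = kernel E s (B ∩ D n) := by
      have hf : (s.pts ∩ D n).Finite := (s.locallyFinite _ (isCompact_compactCovering E n)).subset
        (inter_subset_inter_right _ (disjointed_subset _ _))
      have hc : s.count (D n) = (hf.toFinset.card : ℕ∞) := by
        rw [count, hf.encard_eq_coe_toFinset_card]
      rw [tsum_eq_single hf.toFinset.card]
      · simp only [κ, Kernel.piecewise_apply]
        rw [if_pos (by exact hc), Kernel.restrict_apply, Measure.restrict_apply hB]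
      · intro k hk
        simp only [κ, Kernel.piecewise_apply]
        rw [if_neg]
        · simp
        · intro h
          simp only [mem_ofPred_eq] at h
          rw [hc] at h
          exact hk (by exact_mod_cast h.symm)
    simp_rw [hn]
    rw [← measure_iUnion]
    · rw [← inter_iUnion, iUnion_disjointed, iUnion_compactCovering, inter_univ]
    · exact fun i j hij => (disjoint_disjointed _ hij).mono inter_subset_right inter_subset_right
    · exact fun n => hB.inter (hDm n)
  rw [heq]
  infer_instance

theorem measurable_lintegral {A : Type*} [MeasurableSpace A] {h : A × E → ℝ≥0∞}
    (hh : Measurable h) :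
    Measurable (fun q : A × Configuration E => ∫⁻ x, h (q.1, x) ∂q.2.measure) :=
  Measurable.lintegral_kernel_prod_right' (κ := Kernel.prodMkLeft A (kernel E))
    (f := fun p : (A × Configuration E) × E => h (p.1.1, p.2)) (by fun_prop)

/-- The infimum is below `r` exactly when the counting measure charges the sublevel set of `h`, and
the mass of a section is measurable for an s-finite kernel. Distances to point processes are the
application. -/
theorem measurable_iInf_pts {A : Type*} [MeasurableSpace A] {h : A × E → ℝ≥0∞}
    (hh : Measurable h) :
    Measurable (fun q : A × Configuration E => ⨅ x ∈ q.2.pts, h (q.1, x)) := by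
  refine measurable_of_Iio fun r => ?_
  have hm : MeasurableSet {p : (A × Configuration E) × E | h (p.1.1, p.2) < r} :=
    measurableSet_lt (by fun_prop) measurable_const
  have key := Kernel.measurable_kernel_prodMk_left
    (κ := Kernel.prodMkLeft A (kernel E)) hm
  have : (fun q : A × Configuration E => ⨅ x ∈ q.2.pts, h (q.1, x)) ⁻¹' Iio r =
      {q | Kernel.prodMkLeft A (kernel E) q (Prod.mk q ⁻¹'
        {p : (A × Configuration E) × E | h (p.1.1, p.2) < r}) = 0}ᶜ := by
    ext q
    simp only [mem_preimage, mem_Iio, iInf_lt_iff, mem_compl_iff, mem_ofPred_eq]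
    rw [Kernel.prodMkLeft_apply, kernel_apply, ← ne_eq,
      measure_ne_zero_iff _ (measurable_prodMk_left hm)]
    simp
  rw [this]
  exact (key (measurableSet_singleton 0)).compl

end Configuration

/-! ### Mean and Laplace transform of the Poisson law. -/

section PoissonMeasure

theorem lintegral_poissonMeasure_natCast (r : NNReal) :
    ∫⁻ n, (n : ℝ≥0∞) ∂poissonMeasure r = r := by
  rw [lintegral_countable']
  simp_rw [poissonMeasure_singleton]
  rw [tsum_eq_zero_add' ENNReal.summable]
  simp only [Nat.cast_zero, zero_mul, zero_add]
  have h (n : ℕ) : ((n + 1 : ℕ) : ℝ≥0∞) *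
      ENNReal.ofReal (Real.exp (-r) * r ^ (n + 1) / (n + 1).factorial) =
      r * ENNReal.ofReal (Real.exp (-r) * r ^ n / n.factorial) := by
    rw [← ENNReal.ofReal_natCast, ← ENNReal.ofReal_coe_nnreal,
      ← ENNReal.ofReal_mul (by positivity), ← ENNReal.ofReal_mul (by positivity)]
    congr 1
    rw [Nat.factorial_succ]
    push_cast
    field_simp
    ring
  simp_rw [h]
  rw [ENNReal.tsum_mul_left, ← ENNReal.ofReal_tsum_of_nonneg (fun n => by positivity)
    (hasSum_one_poissonMeasure r).summable, (hasSum_one_poissonMeasure r).tsum_eq]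
  simp

theorem lintegral_poissonMeasure_expNeg (r : NNReal) {c : ℝ≥0∞} (hc : c ≠ ∞) :
    ∫⁻ n, expNeg (c * (n : ℝ≥0∞)) ∂poissonMeasure r = expNeg ((1 - expNeg c) * r) := by
  lift c to NNReal using hc
  rw [lintegral_countable']
  simp_rw [poissonMeasure_singleton]
  have h (n : ℕ) : expNeg (c * (n : ℝ≥0∞)) *
      ENNReal.ofReal (Real.exp (-r) * r ^ n / n.factorial) =
      ENNReal.ofReal (Real.exp (-r) * ((Real.exp (-c) * r) ^ n / n.factorial)) := by
    rw [← ENNReal.ofReal_natCast, ← ENNReal.ofReal_coe_nnreal,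
      ← ENNReal.ofReal_mul (by positivity), expNeg_ofReal (by positivity),
      ← ENNReal.ofReal_mul (by positivity), mul_pow, ← Real.exp_nat_mul]
    congr 1
    rw [show (n : ℝ) * -(c : ℝ) = -(c * n) by ring]
    ring
  simp_rw [h]
  have hs : HasSum (fun n : ℕ => (Real.exp (-c) * r) ^ n / n.factorial)
      (Real.exp (Real.exp (-c) * r)) := by
    rw [Real.exp_eq_exp_ℝ]
    exact NormedSpace.expSeries_div_hasSum_exp _
  rw [← ENNReal.ofReal_tsum_of_nonneg (fun n => by positivity) (hs.mul_left _).summable,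
    (hs.mul_left _).tsum_eq]
  have he : Real.exp (-c) ≤ 1 := Real.exp_le_one_iff.2 (by simp)
  have h2 : (1 - expNeg c) * r = ENNReal.ofReal ((1 - Real.exp (-c)) * r) := by
    rw [← ENNReal.ofReal_coe_nnreal (p := c), expNeg_ofReal (by positivity), ← ENNReal.ofReal_one,
      ← ENNReal.ofReal_sub _ (by positivity), ← ENNReal.ofReal_coe_nnreal (p := r),
      ← ENNReal.ofReal_mul (by linarith)]
  rw [h2, expNeg_ofReal (mul_nonneg (by linarith) (by positivity)), ← Real.exp_add]
  congr 2
  ring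

end PoissonMeasure

/-! ### Poisson processes: counts, Laplace functional, Campbell's formula. -/

namespace IsPoissonProcess

section

variable {Ω E : Type*} [MeasurableSpace Ω] [TopologicalSpace E] [MeasurableSpace E]
  {P : Measure Ω} {N : Ω → Configuration E} {Λ : Measure E}

/-- The field `law` only speaks of finite values. These already carry total mass one, so the value
`⊤` is compared through its complement. -/
theorem map_count [IsProbabilityMeasure P] (hN : IsPoissonProcess P N Λ) {B : Set E}
    (hB : MeasurableSet B) (hΛ : Λ B ≠ ∞) :
    P.map (fun ω => (N ω).count B) =
      (poissonMeasure (Λ B).toNNReal).map (fun n : ℕ => (n : ℕ∞)) := by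
  have hm : Measurable fun ω => (N ω).count B :=
    (Configuration.measurable_count hB).comp hN.measurable
  have hp := Measure.isProbabilityMeasure_map (μ := P) hm.aemeasurable
  have hc : Measurable (fun n : ℕ => (n : ℕ∞)) := .of_discrete
  have hq := Measure.isProbabilityMeasure_map (μ := poissonMeasure (Λ B).toNNReal) hc.aemeasurable
  have h1 (k : ℕ) : P.map (fun ω => (N ω).count B) {(k : ℕ∞)} =
      (poissonMeasure (Λ B).toNNReal).map (fun n : ℕ => (n : ℕ∞)) {(k : ℕ∞)} := by
    rw [Measure.map_apply hm (measurableSet_singleton _),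
      Measure.map_apply hc (measurableSet_singleton _)]
    convert! hN.law B hB hΛ k using 2
    ext n
    simp
  have h2 : ({⊤} : Set ℕ∞) = (⋃ k : ℕ, {(k : ℕ∞)})ᶜ := by
    ext n
    cases n <;> simp
  refine Measure.ext_of_singleton fun n => ?_
  cases n with
  | coe k => exact h1 k
  | top =>
    rw [h2, prob_compl_eq_one_sub .of_discrete, prob_compl_eq_one_sub .of_discrete,
      measure_iUnion _ fun _ => measurableSet_singleton _,
      measure_iUnion _ fun _ => measurableSet_singleton _]
    · simp_rw [h1]
    all_goals exact fun i j hij => by simpa using hij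

theorem lintegral_comp_count [IsProbabilityMeasure P] (hN : IsPoissonProcess P N Λ) {B : Set E}
    (hB : MeasurableSet B) (hΛ : Λ B ≠ ∞) (g : ℝ≥0∞ → ℝ≥0∞) :
    ∫⁻ ω, g ((N ω).count B : ℝ≥0∞) ∂P = ∫⁻ n : ℕ, g (n : ℝ≥0∞) ∂poissonMeasure (Λ B).toNNReal := by
  have hm : Measurable fun ω => (N ω).count B :=
    (Configuration.measurable_count hB).comp hN.measurable
  rw [← lintegral_map (f := fun n : ℕ∞ => g (n : ℝ≥0∞)) .of_discrete hm, hN.map_count hB hΛ,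
    lintegral_map .of_discrete .of_discrete]
  simp

theorem lintegral_count [IsProbabilityMeasure P] (hN : IsPoissonProcess P N Λ) {B : Set E}
    (hB : MeasurableSet B) (hΛ : Λ B ≠ ∞) :
    ∫⁻ ω, ((N ω).count B : ℝ≥0∞) ∂P = Λ B := by
  rw [hN.lintegral_comp_count hB hΛ (fun x => x), lintegral_poissonMeasure_natCast,
    ENNReal.coe_toNNReal hΛ]

theorem measure_count_eq_zero (hN : IsPoissonProcess P N Λ) {B : Set E}
    (hB : MeasurableSet B) (hΛ : Λ B ≠ ∞) :
    P {ω | (N ω).count B = 0} = expNeg (Λ B) := by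
  have h := hN.law B hB hΛ 0
  rw [poissonMeasure_singleton] at h
  rw [← ENNReal.coe_toNNReal hΛ, ← ENNReal.ofReal_coe_nnreal, expNeg_ofReal (by positivity)]
  simpa using h

end

variable {Ω E : Type*} [MeasurableSpace Ω] [TopologicalSpace E] [SigmaCompactSpace E]
  [MeasurableSpace E] [T2Space E] [BorelSpace E]
  {P : Measure Ω} [IsProbabilityMeasure P] {N : Ω → Configuration E} {Λ : Measure E}

/-- The fibres of `f` are disjoint, so their counts are independent and the expectation factors into
Poisson Laplace transforms. -/
theorem laplace_simpleFunc (hN : IsPoissonProcess P N Λ) (f : SimpleFunc E ℝ≥0∞)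
    (hf : ∀ x, f x ≠ ∞) (hΛ : Λ {x | f x ≠ 0} ≠ ∞) :
    ∫⁻ ω, expNeg (∫⁻ x, f x ∂(N ω).measure) ∂P = expNeg (∫⁻ x, (1 - expNeg (f x)) ∂Λ) := by
  have h1 (ω : Ω) : expNeg (∫⁻ x, f x ∂(N ω).measure) =
      ∏ y : f.range, expNeg (y * ((N ω).count (f ⁻¹' {(y : ℝ≥0∞)}) : ℝ≥0∞)) := by
    rw [f.lintegral_eq_lintegral, SimpleFunc.lintegral, expNeg_sum, ← Finset.prod_coe_sort]
    simp_rw [Configuration.measure_apply _ (f.measurableSet_fiber _)]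
  have h2 : ∫⁻ x, (1 - expNeg (f x)) ∂Λ =
      ∑ y : f.range, (1 - expNeg y) * Λ (f ⁻¹' {(y : ℝ≥0∞)}) := by
    rw [Finset.sum_coe_sort f.range (fun y => (1 - expNeg y) * Λ (f ⁻¹' {y})),
      ← SimpleFunc.map_lintegral, ← SimpleFunc.lintegral_eq_lintegral]
    rfl
  have hm (y : f.range) : Measurable fun ω =>
      expNeg (y * ((N ω).count (f ⁻¹' {(y : ℝ≥0∞)}) : ℝ≥0∞)) :=
    (Measurable.of_discrete (f := fun n : ℕ∞ => expNeg (y * (n : ℝ≥0∞)))).comp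
      ((Configuration.measurable_count (f.measurableSet_fiber _)).comp hN.measurable)
  have hind : iIndepFun (fun (y : f.range) ω =>
      expNeg (y * ((N ω).count (f ⁻¹' {(y : ℝ≥0∞)}) : ℝ≥0∞))) P := by
    let e := f.range.equivFin
    have h := hN.indep _ (fun i => f ⁻¹' {((e.symm i : f.range) : ℝ≥0∞)})
      (fun i => f.measurableSet_fiber _) (fun i j hij => by
        refine Disjoint.preimage _ (disjoint_singleton.2 fun h => hij ?_)
        exact e.symm.injective (Subtype.ext h))
    have h' := h.precomp e.injective
    simp only [Equiv.symm_apply_apply] at h'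
    exact h'.comp (fun y (n : ℕ∞) => expNeg (y * (n : ℝ≥0∞))) (fun _ => .of_discrete)
  simp_rw [h1]
  rw [lintegral_prod_eq_prod_lintegral_of_indepFun _ _ hind hm, h2, expNeg_sum]
  refine Finset.prod_congr rfl fun y _ => ?_
  -- The zero fibre may have infinite intensity, where no Poisson law is available, but its factor
  -- is `1` on both sides.
  by_cases hy : (y : ℝ≥0∞) = 0
  · simp [hy]
  · have hfin : Λ (f ⁻¹' {(y : ℝ≥0∞)}) ≠ ∞ := by
      refine ne_top_of_le_ne_top hΛ (measure_mono fun x hx => ?_)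
      simp only [mem_preimage, mem_singleton_iff] at hx
      simpa [hx] using hy
    have hy' : (y : ℝ≥0∞) ≠ ∞ := by
      obtain ⟨x, hx⟩ := SimpleFunc.mem_range.1 y.2
      rw [← hx]; exact hf x
    rw [hN.lintegral_comp_count (f.measurableSet_fiber _) hfin (fun n => expNeg (y * n)),
      lintegral_poissonMeasure_expNeg _ hy', ENNReal.coe_toNNReal hfin]

/-- The Laplace functional of a Poisson process. -/
theorem laplace (hN : IsPoissonProcess P N Λ) {f : E → ℝ≥0∞} (hfm : Measurable f)
    (hΛ : Λ {x | f x ≠ 0} ≠ ∞) :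
    ∫⁻ ω, expNeg (∫⁻ x, f x ∂(N ω).measure) ∂P = expNeg (∫⁻ x, (1 - expNeg (f x)) ∂Λ) := by
  have hle (n : ℕ) (x : E) : SimpleFunc.eapprox f n x ≤ f x := by
    rw [← SimpleFunc.iSup_eapprox_apply hfm x]
    exact le_iSup (fun n => SimpleFunc.eapprox f n x) n
  have hmono (x : E) : Monotone fun n => SimpleFunc.eapprox f n x :=
    fun i j hij => SimpleFunc.monotone_eapprox f hij x
  have htend (x : E) : Filter.Tendsto (fun n => SimpleFunc.eapprox f n x) .atTop (nhds (f x)) := by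
    rw [← SimpleFunc.iSup_eapprox_apply hfm x]
    exact tendsto_atTop_iSup (hmono x)
  have hn (n : ℕ) := hN.laplace_simpleFunc (SimpleFunc.eapprox f n)
    (fun x => (SimpleFunc.eapprox_lt_top f n x).ne)
    (ne_top_of_le_ne_top hΛ (measure_mono fun x hx h0 => hx (by simpa [h0] using hle n x)))
  have hR : Filter.Tendsto
      (fun n => expNeg (∫⁻ x, (1 - expNeg (SimpleFunc.eapprox f n x)) ∂Λ)) .atTop
      (nhds (expNeg (∫⁻ x, (1 - expNeg (f x)) ∂Λ))) := by
    refine (continuous_expNeg.tendsto _).comp ?_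
    refine lintegral_tendsto_of_tendsto_of_monotone (fun n => ?_) (.of_forall fun x i j hij => ?_)
      (.of_forall fun x => ?_)
    · exact (measurable_const.sub
        (measurable_expNeg.comp (SimpleFunc.eapprox f n).measurable)).aemeasurable
    · exact tsub_le_tsub_left (antitone_expNeg (hmono x hij)) _
    · exact ENNReal.Tendsto.sub tendsto_const_nhds
        ((continuous_expNeg.tendsto _).comp (htend x)) (.inl (by simp))
  have hmeas (g : E → ℝ≥0∞) (hg : Measurable g) :
      Measurable fun ω => ∫⁻ x, g x ∂(N ω).measure :=
    (Measurable.lintegral_kernel (κ := Configuration.kernel E) hg).comp hN.measurable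
  have hL : Filter.Tendsto
      (fun n => ∫⁻ ω, expNeg (∫⁻ x, SimpleFunc.eapprox f n x ∂(N ω).measure) ∂P) .atTop
      (nhds (∫⁻ ω, expNeg (∫⁻ x, f x ∂(N ω).measure) ∂P)) := by
    refine tendsto_lintegral_of_dominated_convergence (fun _ => 1)
      (fun n => measurable_expNeg.comp (hmeas _ (SimpleFunc.eapprox f n).measurable))
      (fun n => .of_forall fun ω => expNeg_le_one _) (by simp) (.of_forall fun ω => ?_)
    refine (continuous_expNeg.tendsto _).comp ?_
    exact lintegral_tendsto_of_tendsto_of_monotone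
      (fun n => (SimpleFunc.eapprox f n).measurable.aemeasurable)
      (.of_forall hmono) (.of_forall htend)
  refine tendsto_nhds_unique hL ?_
  simp_rw [hn]
  exact hR

/-- Campbell's formula, for an integrand that depends on an independent random element. -/
theorem campbell (hN : IsPoissonProcess P N Λ) [SFinite Λ] {F : Type*} [MeasurableSpace F]
    {Y : Ω → F} (hY : Measurable Y) (hNY : IndepFun N Y P) {U : Set E} (hU : MeasurableSet U)
    (hΛ : Λ U ≠ ∞) {f : F × E → ℝ≥0∞} (hf : Measurable f) :
    ∫⁻ ω, ∫⁻ x in U, f (Y ω, x) ∂(N ω).measure ∂P = ∫⁻ x in U, ∫⁻ ω, f (Y ω, x) ∂P ∂Λ := by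
  have hprod := (indepFun_iff_map_prod_eq_prod_map_map hN.measurable.aemeasurable
    hY.aemeasurable).1 hNY
  have hpN := Measure.isProbabilityMeasure_map (μ := P) hN.measurable.aemeasurable
  have hpY := Measure.isProbabilityMeasure_map (μ := P) hY.aemeasurable
  -- The mean measure of the process is its intensity; restricting to `U` keeps every set within
  -- reach of the law of counts.
  have hmean : ((P.map N).bind (Configuration.kernel E)).restrict U = Λ.restrict U := by
    ext B hB
    rw [Measure.restrict_apply hB, Measure.restrict_apply hB,
      Measure.bind_apply (hB.inter hU) (Kernel.aemeasurable _),
      lintegral_map (Kernel.measurable_coe _ (hB.inter hU)) hN.measurable]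
    simp_rw [Configuration.kernel_apply, Configuration.measure_apply _ (hB.inter hU)]
    exact hN.lintegral_count (hB.inter hU)
      (ne_top_of_le_ne_top hΛ (measure_mono inter_subset_right))
  have hm : Measurable fun q : F × Configuration E => ∫⁻ x in U, f (q.1, x) ∂q.2.measure := by
    have h := Configuration.measurable_lintegral
      (h := fun p : F × E => U.indicator (fun x => f (p.1, x)) p.2) (by
        have : (fun p : F × E => U.indicator (fun x => f (p.1, x)) p.2) =
            (Prod.snd ⁻¹' U).indicator f := by
          ext p
          by_cases hp : p.2 ∈ U <;> simp [indicator, hp]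
        rw [this]
        exact hf.indicator (measurable_snd hU))
    simpa only [lintegral_indicator hU] using h
  calc ∫⁻ ω, ∫⁻ x in U, f (Y ω, x) ∂(N ω).measure ∂P
      = ∫⁻ q, ∫⁻ x in U, f (q.2, x) ∂q.1.measure ∂(P.map fun ω => (N ω, Y ω)) :=
        (lintegral_map (hm.comp measurable_swap) (hN.measurable.prodMk hY)).symm
    _ = ∫⁻ y, ∫⁻ s, ∫⁻ x in U, f (y, x) ∂s.measure ∂(P.map N) ∂(P.map Y) := by
        rw [hprod]
        exact lintegral_prod_symm' _ (hm.comp measurable_swap)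
    _ = ∫⁻ y, ∫⁻ x in U, f (y, x) ∂Λ ∂(P.map Y) := by
        refine lintegral_congr fun y => ?_
        have hfy : Measurable fun x => f (y, x) := hf.comp measurable_prodMk_left
        simp_rw [← lintegral_indicator hU]
        refine (Measure.lintegral_bind (m := P.map N) (μ := Configuration.kernel E)
          (Kernel.aemeasurable _) (hfy.indicator hU).aemeasurable).symm.trans ?_
        rw [lintegral_indicator hU, hmean, lintegral_indicator hU]
    _ = ∫⁻ x in U, ∫⁻ y, f (y, x) ∂(P.map Y) ∂Λ := lintegral_lintegral_swap hf.aemeasurable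
    _ = _ := by
        refine lintegral_congr fun x => ?_
        exact lintegral_map (hf.comp measurable_prodMk_right) hY

end IsPoissonProcess

/-! ### Chords cut by a disc on a road, and the unit square. -/

section Geometry

theorem continuous_roadPoint : Continuous fun q : (ℝ × ℝ) × ℝ => roadPoint q.1 q.2 := by
  refine (PiLp.continuous_toLp 2 _).comp (continuous_pi fun i => ?_)
  fin_cases i
  · change Continuous fun q : (ℝ × ℝ) × ℝ => q.1.1 * Real.cos q.1.2 - q.2 * Real.sin q.1.2
    fun_prop
  · change Continuous fun q : (ℝ × ℝ) × ℝ => q.1.1 * Real.sin q.1.2 + q.2 * Real.cos q.1.2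
    fun_prop

theorem norm_roadPoint (p : ℝ × ℝ) (t : ℝ) : ‖roadPoint p t‖ = √(p.1 ^ 2 + t ^ 2) := by
  have h := Real.sin_sq_add_cos_sq p.2
  rw [EuclideanSpace.norm_eq, Fin.sum_univ_two]
  congr 1
  simp only [roadPoint, PiLp.toLp_apply, Matrix.cons_val_zero, Matrix.cons_val_one,
    Matrix.cons_val_fin_one, Real.norm_eq_abs, sq_abs]
  linear_combination (p.1 ^ 2 + t ^ 2) * h

theorem edist_zero_lt_ofReal_iff (x : Plane) (r : ℝ) :
    edist 0 x < ENNReal.ofReal r ↔ ‖x‖ < r := by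
  rw [edist_dist, dist_zero_left, ENNReal.ofReal_lt_ofReal_iff_of_nonneg (norm_nonneg x)]

/-- By Pythagoras. For a road that misses the disc the square root is `0` and the interval is empty,
so no case split is needed. -/
theorem setOf_edist_roadPoint_lt (p : ℝ × ℝ) {r : ℝ} (hr : 0 ≤ r) :
    {t | edist 0 (roadPoint p t) < ENNReal.ofReal r} =
      Ioo (-√(r ^ 2 - p.1 ^ 2)) √(r ^ 2 - p.1 ^ 2) := by
  ext t
  rw [mem_ofPred_eq, edist_zero_lt_ofReal_iff, norm_roadPoint, mem_Ioo, ← abs_lt,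
    Real.lt_sqrt (abs_nonneg t), sq_abs, lt_sub_iff_add_lt, add_comm (t ^ 2),
    ← Real.sqrt_lt_sqrt_iff (x := p.1 ^ 2 + t ^ 2) (y := r ^ 2) (by positivity), Real.sqrt_sq hr]

theorem unitSquare_eq_preimage : unitSquare =
    (MeasurableEquiv.toLp 2 (Fin 2 → ℝ)).symm ⁻¹' univ.pi fun _ => Ico (0 : ℝ) 1 := by
  ext x
  simp [unitSquare]

theorem measurableSet_unitSquare : MeasurableSet unitSquare := by
  rw [unitSquare_eq_preimage]
  exact (MeasurableEquiv.measurable _) (.univ_pi fun _ => measurableSet_Ico)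

theorem volume_unitSquare : volume unitSquare = 1 := by
  rw [unitSquare_eq_preimage,
    (EuclideanSpace.volume_preserving_symm_measurableEquiv_toLp (Fin 2)).measure_preimage
      (MeasurableSet.univ_pi fun _ => measurableSet_Ico).nullMeasurableSet, volume_pi_pi]
  simp

end Geometry

/-! ### Distance to the stations on the roads, as a measurable function of roads and positions. -/

section RoadDist

/-- The distance from `x` to the points placed on the roads. -/
@[irreducible]
noncomputable def roadDist (x : Plane) (ℓ : ℕ → ℝ × ℝ) (s : ℕ → Configuration ℝ) : ℝ≥0∞ :=
  ⨅ i, ⨅ t ∈ (s i).pts, edist x (roadPoint (ℓ i) t)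

theorem infEDist_iUnion_roadPoint (x : Plane) (ℓ : ℕ → ℝ × ℝ) (s : ℕ → Configuration ℝ) :
    Metric.infEDist x (⋃ i, roadPoint (ℓ i) '' (s i).pts) = roadDist x ℓ s := by
  rw [Metric.infEDist_iUnion, roadDist]
  simp only [Metric.infEDist, iInf_image]

theorem measurable_roadDist :
    Measurable fun q : Plane × (ℕ → ℝ × ℝ) × (ℕ → Configuration ℝ) =>
      roadDist q.1 q.2.1 q.2.2 := by
  simp_rw [roadDist]
  refine Measurable.iInf fun i => ?_
  have h : Measurable fun q : (Plane × (ℝ × ℝ)) × ℝ => edist q.1.1 (roadPoint q.1.2 q.2) := by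
    refine Continuous.measurable ?_
    have := continuous_roadPoint.comp
      (f := fun q : (Plane × (ℝ × ℝ)) × ℝ => (q.1.2, q.2)) (by fun_prop)
    exact (continuous_fst.comp continuous_fst).edist this
  have hg : Measurable fun q : Plane × (ℕ → ℝ × ℝ) × (ℕ → Configuration ℝ) =>
      ((q.1, q.2.1 i), q.2.2 i) := by fun_prop
  exact (Configuration.measurable_iInf_pts h).comp hg

theorem measurable_roadDist_right (x : Plane) :
    Measurable fun q : (ℕ → ℝ × ℝ) × (ℕ → Configuration ℝ) => roadDist x q.1 q.2 :=
  Measurable.of_uncurry_left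
    (f := fun x (q : (ℕ → ℝ × ℝ) × (ℕ → Configuration ℝ)) => roadDist x q.1 q.2)
    measurable_roadDist

theorem measurable_infEDist_pts :
    Measurable fun q : Plane × Configuration Plane => Metric.infEDist q.1 q.2.pts :=
  Configuration.measurable_iInf_pts (h := fun q : Plane × Plane => edist q.1 q.2)
    measurable_edist

end RoadDist

/-! ### Void probabilities of discs for the planar and the vehicular stations. -/

section Void

theorem Configuration.count_eq_zero_iff {E : Type*} [TopologicalSpace E] (s : Configuration E)
    (B : Set E) : s.count B = 0 ↔ ∀ x ∈ s.pts, x ∉ B := by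
  rw [count, encard_eq_zero, ← disjoint_iff_inter_eq_empty, disjoint_left]

/-- The void probabilities of balls for a homogeneous Poisson process of the plane. -/
theorem measure_le_infEDist {Ω : Type*} [MeasurableSpace Ω] {P : Measure Ω}
    {lamb : ℝ} (hlamb : 0 ≤ lamb) {Φ : Ω → Configuration Plane}
    (hΦ : IsPoissonProcess P Φ (ENNReal.ofReal lamb • volume)) {r : ℝ} (hr : 0 ≤ r) :
    P {ω | ENNReal.ofReal r ≤ Metric.infEDist 0 (Φ ω).pts} =
      ENNReal.ofReal (Real.exp (-(Real.pi * lamb * r ^ 2))) := by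
  have hvol : (ENNReal.ofReal lamb • volume) (Metric.ball (0 : Plane) r) =
      ENNReal.ofReal (Real.pi * lamb * r ^ 2) := by
    rw [Measure.smul_apply, EuclideanSpace.volume_ball_fin_two, smul_eq_mul,
      ← ENNReal.ofReal_pow hr, ← ENNReal.ofReal_mul (by positivity),
      ← ENNReal.ofReal_mul hlamb]
    congr 1
    ring
  rw [← expNeg_ofReal (by positivity), ← hvol,
    ← hΦ.measure_count_eq_zero Metric.isOpen_ball.measurableSet (by rw [hvol]; simp)]
  congr 1
  ext ω
  simp only [mem_ofPred_eq, Metric.infEDist, le_iInf_iff, Configuration.count_eq_zero_iff,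
    mem_ball_zero_iff, ← edist_zero_lt_ofReal_iff, not_lt]

variable {Ω : Type*} [MeasurableSpace Ω] {P : Measure Ω} [IsProbabilityMeasure P]

/-- The void probabilities of independent Poisson processes on given roads. -/
theorem measure_le_roadDist_of_deterministic {mub : ℝ} (hmub : 0 ≤ mub)
    {φ : ℕ → Ω → Configuration ℝ}
    (hφ : ∀ i, IsPoissonProcess P (φ i) (ENNReal.ofReal mub • volume)) (hind : iIndepFun φ P)
    (ℓ : ℕ → ℝ × ℝ) {r : ℝ} (hr : 0 ≤ r) :
    P {ω | ENNReal.ofReal r ≤ roadDist 0 ℓ (fun i => φ i ω)} =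
      expNeg (∑' i, ENNReal.ofReal (2 * mub * √(r ^ 2 - (ℓ i).1 ^ 2))) := by
  set J : ℕ → Set ℝ := fun i => Ioo (-√(r ^ 2 - (ℓ i).1 ^ 2)) √(r ^ 2 - (ℓ i).1 ^ 2) with hJ
  have hvol (i : ℕ) : (ENNReal.ofReal mub • volume) (J i) =
      ENNReal.ofReal (2 * mub * √(r ^ 2 - (ℓ i).1 ^ 2)) := by
    rw [Measure.smul_apply, hJ, Real.volume_Ioo, smul_eq_mul, ← ENNReal.ofReal_mul hmub]
    congr 1
    ring
  let S : ℕ → Set (Configuration ℝ) := fun i => {s | s.count (J i) = 0}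
  have hS (i : ℕ) : MeasurableSet (S i) :=
    Configuration.measurable_count measurableSet_Ioo (measurableSet_singleton 0)
  have hPS (i : ℕ) : P (φ i ⁻¹' S i) =
      expNeg (ENNReal.ofReal (2 * mub * √(r ^ 2 - (ℓ i).1 ^ 2))) := by
    rw [← hvol]
    exact (hφ i).measure_count_eq_zero measurableSet_Ioo (by rw [hvol]; simp)
  -- Independence gives products over finitely many roads; continuity of `P` along decreasing events
  -- yields the infinite intersection.
  have hset : {ω | ENNReal.ofReal r ≤ roadDist 0 ℓ (fun i => φ i ω)} =
      ⋂ n : ℕ, ⋂ i ∈ Finset.range n, φ i ⁻¹' S i := by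
    ext ω
    have h1 : ω ∈ {ω | ENNReal.ofReal r ≤ roadDist 0 ℓ (fun i => φ i ω)} ↔
        ∀ i, ω ∈ φ i ⁻¹' S i := by
      simp only [roadDist, mem_ofPred_eq, le_iInf_iff, mem_preimage, S,
        Configuration.count_eq_zero_iff]
      simp only [hJ, ← setOf_edist_roadPoint_lt _ hr, mem_ofPred_eq, not_lt]
    rw [h1]
    simp only [mem_iInter, Finset.mem_range]
    exact ⟨fun h n i _ => h i, fun h i => h (i + 1) i (Nat.lt_succ_self i)⟩
  have hn (n : ℕ) : P (⋂ i ∈ Finset.range n, φ i ⁻¹' S i) =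
      expNeg (∑ i ∈ Finset.range n, ENNReal.ofReal (2 * mub * √(r ^ 2 - (ℓ i).1 ^ 2))) := by
    rw [expNeg_sum, hind.meas_biInter fun i _ => ⟨S i, hS i, rfl⟩]
    simp_rw [hPS]
  have hlim : Filter.Tendsto (fun n => P (⋂ i ∈ Finset.range n, φ i ⁻¹' S i)) .atTop
      (nhds (P (⋂ n : ℕ, ⋂ i ∈ Finset.range n, φ i ⁻¹' S i))) := by
    refine tendsto_measure_iInter_atTop (fun n => ?_) (fun m n hmn => ?_) ⟨0, by finiteness⟩
    · exact (Finset.measurableSet_biInter _ fun i _ => (hφ i).measurable (hS i)).nullMeasurableSet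
    · exact biInter_mono (fun i hi => Finset.range_mono hmn hi) fun _ _ => subset_rfl
  rw [hset]
  refine tendsto_nhds_unique hlim ?_
  simp_rw [hn]
  exact (continuous_expNeg.tendsto _).comp (ENNReal.tendsto_nat_tsum _)

theorem integrable_one_sub_exp_sqrt (mub r : ℝ) :
    Integrable fun t : ℝ => 1 - Real.exp (-2 * mub * √(r ^ 2 - t ^ 2)) := by
  refine Continuous.integrable_of_hasCompactSupport (by fun_prop) ?_
  refine HasCompactSupport.intro (isCompact_Icc (a := -|r|) (b := |r|)) fun t ht => ?_
  have : r ^ 2 - t ^ 2 ≤ 0 := by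
    rw [mem_Icc, ← abs_le, not_le] at ht
    exact sub_nonpos.2 (sq_le_sq.2 ht.le)
  simp [Real.sqrt_eq_zero_of_nonpos this]

theorem integral_one_sub_exp_sqrt (mub : ℝ) {r : ℝ} (hr : 0 ≤ r) :
    ∫ t : ℝ, (1 - Real.exp (-2 * mub * √(r ^ 2 - t ^ 2))) =
      2 * ∫ t in (0 : ℝ)..r, (1 - Real.exp (-2 * mub * √(r ^ 2 - t ^ 2))) := by
  have h := integral_comp_abs (f := fun t : ℝ => 1 - Real.exp (-2 * mub * √(r ^ 2 - t ^ 2)))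
  simp only [sq_abs] at h
  rw [h, intervalIntegral.integral_of_le hr]
  congr 1
  refine setIntegral_eq_of_subset_of_forall_sdiff_eq_zero measurableSet_Ioi
    (fun x hx => hx.1) fun t ht => ?_
  have ht' : r < t := by
    by_contra! h
    exact ht.2 ⟨ht.1, h⟩
  have : r ^ 2 - t ^ 2 ≤ 0 := by nlinarith
  simp [Real.sqrt_eq_zero_of_nonpos this]

/-- The integrand ignores the angle, whose range of length `π` cancels the `π` of the intensity;
evenness in the signed distance gives the factor `2`. -/
theorem lintegral_cylinder_one_sub_exp {laml mub r : ℝ} (hlaml : 0 ≤ laml) (hmub : 0 ≤ mub)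
    (hr : 0 ≤ r) :
    ∫⁻ p : ℝ × ℝ, (1 - expNeg (ENNReal.ofReal (2 * mub * √(r ^ 2 - p.1 ^ 2))))
        ∂(ENNReal.ofReal (laml / Real.pi) • volume.restrict cylinder) =
      ENNReal.ofReal (2 * laml *
        ∫ t in (0 : ℝ)..r, (1 - Real.exp (-2 * mub * √(r ^ 2 - t ^ 2)))) := by
  have h1 (p : ℝ × ℝ) : 1 - expNeg (ENNReal.ofReal (2 * mub * √(r ^ 2 - p.1 ^ 2))) =
      ENNReal.ofReal (1 - Real.exp (-2 * mub * √(r ^ 2 - p.1 ^ 2))) := by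
    rw [expNeg_ofReal (by positivity), ← ENNReal.ofReal_one,
      ← ENNReal.ofReal_sub _ (by positivity)]
    congr 4
    ring
  have h0 (t : ℝ) : 0 ≤ 1 - Real.exp (-2 * mub * √(r ^ 2 - t ^ 2)) := by
    rw [sub_nonneg, Real.exp_le_one_iff]
    have : 0 ≤ mub * √(r ^ 2 - t ^ 2) := by positivity
    linarith
  have hm : Measurable fun t : ℝ =>
      ENNReal.ofReal (1 - Real.exp (-2 * mub * √(r ^ 2 - t ^ 2))) := by fun_prop
  simp_rw [h1]
  rw [lintegral_smul_measure, cylinder, Measure.volume_eq_prod, ← Measure.prod_restrict,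
    Measure.restrict_univ, lintegral_prod _ (by fun_prop)]
  simp only [lintegral_const, Measure.restrict_apply_univ, Real.volume_Ico, sub_zero, smul_eq_mul]
  rw [lintegral_mul_const _ hm, ← ofReal_integral_eq_lintegral_ofReal
    (integrable_one_sub_exp_sqrt mub r) (.of_forall h0), ← ENNReal.ofReal_mul (integral_nonneg h0),
    ← ENNReal.ofReal_mul (by positivity), integral_one_sub_exp_sqrt mub hr]
  congr 1
  field_simp

/-- Only roads with signed distance in `[-r, r]` contribute, a set of finite intensity, as the
Laplace functional requires. -/
theorem cylinder_support_sqrt_ne_top (laml mub : ℝ) {r : ℝ} (hr : 0 ≤ r) :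
    (ENNReal.ofReal (laml / Real.pi) • volume.restrict cylinder)
    {p : ℝ × ℝ | ENNReal.ofReal (2 * mub * √(r ^ 2 - p.1 ^ 2)) ≠ 0} ≠ ∞ := by
  have hsub : {p : ℝ × ℝ | ENNReal.ofReal (2 * mub * √(r ^ 2 - p.1 ^ 2)) ≠ 0} ⊆
      Icc (-r) r ×ˢ univ := by
    intro p hp
    refine ⟨?_, mem_univ _⟩
    by_contra h
    rw [mem_Icc, ← abs_le, not_le] at h
    have : r ^ 2 - p.1 ^ 2 ≤ 0 := sub_nonpos.2 (sq_le_sq.2 (by rw [abs_of_nonneg hr]; exact h.le))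
    exact hp (by simp [Real.sqrt_eq_zero_of_nonpos this])
  refine ne_top_of_le_ne_top ?_ (measure_mono hsub)
  rw [Measure.smul_apply, cylinder, Measure.volume_eq_prod, ← Measure.prod_restrict,
    Measure.prod_prod]
  simp [ENNReal.mul_eq_top]

/-- The void probabilities of the Cox process of the points placed on a Poisson line process. -/
theorem measure_le_roadDist {laml mub : ℝ} (hlaml : 0 ≤ laml) (hmub : 0 ≤ mub)
    {Ξ : Ω → Configuration (ℝ × ℝ)} {L : ℕ → Ω → ℝ × ℝ} {φ : ℕ → Ω → Configuration ℝ}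
    (hΞ : IsPoissonProcess P Ξ (ENNReal.ofReal (laml / Real.pi) • volume.restrict cylinder))
    (hLm : ∀ i, Measurable (L i)) (hLi : ∀ ω, Function.Injective fun i => L i ω)
    (hLr : ∀ ω, range (fun i => L i ω) = (Ξ ω).pts)
    (hφ : ∀ i, IsPoissonProcess P (φ i) (ENNReal.ofReal mub • volume)) (hind : iIndepFun φ P)
    (hLφ : IndepFun (fun ω i => L i ω) (fun ω i => φ i ω) P) {r : ℝ} (hr : 0 ≤ r) :
    P {ω | ENNReal.ofReal r ≤ roadDist 0 (fun i => L i ω) (fun i => φ i ω)} =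
      ENNReal.ofReal (Real.exp (-(2 * laml *
        ∫ t in (0 : ℝ)..r, (1 - Real.exp (-2 * mub * √(r ^ 2 - t ^ 2)))))) := by
  have hL : Measurable fun ω i => L i ω := measurable_pi_lambda _ hLm
  have hφm : Measurable fun ω i => φ i ω := measurable_pi_lambda _ fun i => (hφ i).measurable
  have hprod := (indepFun_iff_map_prod_eq_prod_map_map hL.aemeasurable hφm.aemeasurable).1 hLφ
  have hp := Measure.isProbabilityMeasure_map (μ := P) hφm.aemeasurable
  have hS : MeasurableSet {q : (ℕ → ℝ × ℝ) × (ℕ → Configuration ℝ) |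
      ENNReal.ofReal r ≤ roadDist 0 q.1 q.2} :=
    measurableSet_le measurable_const (measurable_roadDist_right 0)
  have hfm : Measurable fun p : ℝ × ℝ => ENNReal.ofReal (2 * mub * √(r ^ 2 - p.1 ^ 2)) := by
    fun_prop
  calc P {ω | ENNReal.ofReal r ≤ roadDist 0 (fun i => L i ω) (fun i => φ i ω)}
      = P.map (fun ω => ((fun i => L i ω), (fun i => φ i ω)))
          {q | ENNReal.ofReal r ≤ roadDist 0 q.1 q.2} :=
        (Measure.map_apply (hL.prodMk hφm) hS).symm
    _ = ∫⁻ ℓ, expNeg (∑' i, ENNReal.ofReal (2 * mub * √(r ^ 2 - (ℓ i).1 ^ 2)))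
          ∂(P.map fun ω i => L i ω) := by
        rw [hprod, Measure.prod_apply hS]
        refine lintegral_congr fun ℓ => ?_
        rw [Measure.map_apply hφm (measurable_prodMk_left hS)]
        exact measure_le_roadDist_of_deterministic hmub hφ hind ℓ hr
    _ = ∫⁻ ω, expNeg (∫⁻ p, ENNReal.ofReal (2 * mub * √(r ^ 2 - p.1 ^ 2)) ∂(Ξ ω).measure) ∂P := by
        have hm : Measurable fun ℓ : ℕ → ℝ × ℝ =>
            expNeg (∑' i, ENNReal.ofReal (2 * mub * √(r ^ 2 - (ℓ i).1 ^ 2))) :=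
          measurable_expNeg.comp
            (Measurable.tsum fun i => hfm.comp (measurable_pi_apply i))
        rw [lintegral_map hm hL]
        refine lintegral_congr fun ω => ?_
        -- The numbering is injective with range the points of `Ξ`, so the series over indices is an
        -- integral against the line process.
        rw [Configuration.lintegral_measure, ← hLr ω,
          tsum_range (fun p : ℝ × ℝ => ENNReal.ofReal (2 * mub * √(r ^ 2 - p.1 ^ 2))) (hLi ω)]
    _ = _ := by
        rw [hΞ.laplace hfm (cylinder_support_sqrt_ne_top laml mub hr),
          lintegral_cylinder_one_sub_exp hlaml hmub hr, expNeg_ofReal]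
        refine mul_nonneg (by positivity) (intervalIntegral.integral_nonneg hr fun t _ => ?_)
        rw [sub_nonneg, Real.exp_le_one_iff]
        have : 0 ≤ mub * √(r ^ 2 - t ^ 2) := by positivity
        linarith

end Void

/-! ### Law of the nearest planar distance, and comparison of independent distances. -/

section NearestLaw

theorem lintegral_Ioi_rayleigh {c r : ℝ} (hc : 0 < c) (hr : 0 ≤ r) :
    ∫⁻ x in Ioi r, ENNReal.ofReal (2 * c * x * Real.exp (-(c * x ^ 2))) =
      ENNReal.ofReal (Real.exp (-(c * r ^ 2))) := by
  have hderiv (x : ℝ) : HasDerivAt (fun x => -Real.exp (-(c * x ^ 2)))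
      (2 * c * x * Real.exp (-(c * x ^ 2))) x := by
    have h := (((hasDerivAt_pow 2 x).const_mul c).neg.exp).neg
    convert! h using 1
    simp
    ring
  have hpos (x : ℝ) (hx : x ∈ Ioi r) : 0 ≤ 2 * c * x * Real.exp (-(c * x ^ 2)) := by
    have : 0 < x := hr.trans_lt hx
    positivity
  have hlim : Filter.Tendsto (fun x : ℝ => -Real.exp (-(c * x ^ 2))) .atTop (nhds 0) := by
    rw [← neg_zero]
    refine (Real.tendsto_exp_atBot.comp (Filter.tendsto_neg_atTop_atBot.comp ?_)).neg
    exact (Filter.tendsto_pow_atTop two_ne_zero).const_mul_atTop hc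
  rw [← ofReal_integral_eq_lintegral_ofReal
    (integrableOn_Ioi_deriv_of_nonneg' (fun x _ => hderiv x) hpos hlim)
    ((ae_restrict_iff' measurableSet_Ioi).2 (.of_forall hpos)),
    integral_Ioi_of_hasDerivAt_of_nonneg' (fun x _ => hderiv x) hpos hlim]
  simp

/-- The Rayleigh law on `[0, ∞]`, the law of the distance to the closest point of a homogeneous
Poisson process of intensity `c / π`. -/
noncomputable def rayleigh (c : ℝ) : Measure ℝ≥0∞ :=
  ((volume.restrict (Ioi 0)).withDensity
    fun x => ENNReal.ofReal (2 * c * x * Real.exp (-(c * x ^ 2)))).map ENNReal.ofReal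

theorem lintegral_rayleigh (c : ℝ) {g : ℝ≥0∞ → ℝ≥0∞} (hg : Measurable g) :
    ∫⁻ a, g a ∂rayleigh c = ∫⁻ x in Ioi 0,
      ENNReal.ofReal (2 * c * x * Real.exp (-(c * x ^ 2))) * g (ENNReal.ofReal x) := by
  rw [rayleigh, lintegral_map hg ENNReal.measurable_ofReal,
    lintegral_withDensity_eq_lintegral_mul _ (by fun_prop) (by fun_prop)]
  rfl

theorem rayleigh_singleton (c : ℝ) (a : ℝ≥0∞) : rayleigh c {a} = 0 := by
  rw [rayleigh, Measure.map_apply ENNReal.measurable_ofReal (measurableSet_singleton a)]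
  refine withDensity_absolutelyContinuous _ _ ?_
  rw [Measure.restrict_apply (ENNReal.measurable_ofReal (measurableSet_singleton a))]
  refine measure_mono_null (t := {a.toReal}) (fun x hx => ?_) (by simp)
  have h : ENNReal.ofReal x = a := hx.1
  rw [mem_singleton_iff, ← h, ENNReal.toReal_ofReal (le_of_lt hx.2)]

theorem rayleigh_Ici_ofReal {c r : ℝ} (hc : 0 < c) (hr : 0 ≤ r) :
    rayleigh c (Ici (ENNReal.ofReal r)) = ENNReal.ofReal (Real.exp (-(c * r ^ 2))) := by
  rw [← lintegral_Ioi_rayleigh hc hr, rayleigh,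
    Measure.map_apply ENNReal.measurable_ofReal measurableSet_Ici,
    withDensity_apply _ (ENNReal.measurable_ofReal measurableSet_Ici),
    Measure.restrict_restrict (ENNReal.measurable_ofReal measurableSet_Ici)]
  have : (ENNReal.ofReal ⁻¹' Ici (ENNReal.ofReal r) ∩ Ioi 0 : Set ℝ) =ᵐ[volume]
      (Ioi r : Set ℝ) := by
    have h1 : ENNReal.ofReal ⁻¹' Ici (ENNReal.ofReal r) ∩ Ioi 0 = Ici r ∩ Ioi 0 := by
      ext x
      simp only [mem_inter_iff, mem_preimage, mem_Ici, mem_Ioi, and_congr_left_iff]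
      exact fun hx => ENNReal.ofReal_le_ofReal_iff hx.le
    have h2 : Ioi r ∩ Ioi 0 = Ioi r := inter_eq_left.2 (Ioi_subset_Ioi hr)
    rw [h1]
    exact (Ioi_ae_eq_Ici.symm.inter .rfl).trans (.of_eq h2)
  rw [setLIntegral_congr this]

variable {Ω : Type*} [MeasurableSpace Ω] {P : Measure Ω} [IsProbabilityMeasure P]

theorem map_infEDist_eq_rayleigh {lamb : ℝ} (hlamb : 0 < lamb) {Φ : Ω → Configuration Plane}
    (hΦ : IsPoissonProcess P Φ (ENNReal.ofReal lamb • volume)) :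
    P.map (fun ω => Metric.infEDist 0 (Φ ω).pts) = rayleigh (Real.pi * lamb) := by
  have hc : 0 < Real.pi * lamb := by positivity
  have hm : Measurable fun ω => Metric.infEDist (0 : Plane) (Φ ω).pts :=
    (measurable_infEDist_pts.of_uncurry_left
      (f := fun (x : Plane) (s : Configuration Plane) => Metric.infEDist x s.pts)).comp hΦ.measurable
  have h1 {r : ℝ} (hr : 0 ≤ r) : P.map (fun ω => Metric.infEDist 0 (Φ ω).pts)
      (Ici (ENNReal.ofReal r)) = rayleigh (Real.pi * lamb) (Ici (ENNReal.ofReal r)) := by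
    rw [rayleigh_Ici_ofReal hc hr, Measure.map_apply hm measurableSet_Ici,
      ← measure_le_infEDist hlamb.le hΦ hr]
    rfl
  have hp := Measure.isProbabilityMeasure_map (μ := P) hm.aemeasurable
  refine Measure.ext_of_Ici _ _ fun a => ?_
  cases a with
  | coe a => simpa using h1 a.2
  | top =>
    rw [Ici_top, rayleigh_singleton]
    -- The value `∞` means that there is no planar station; its probability is below every tail,
    -- hence zero.
    have hlim : Filter.Tendsto (fun r : ℝ => ENNReal.ofReal
        (Real.exp (-(Real.pi * lamb * r ^ 2)))) .atTop (nhds 0) := by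
      rw [← ENNReal.ofReal_zero]
      refine ENNReal.tendsto_ofReal (Real.tendsto_exp_atBot.comp
        (Filter.tendsto_neg_atTop_atBot.comp ?_))
      exact (Filter.tendsto_pow_atTop two_ne_zero).const_mul_atTop hc
    refine le_antisymm (ge_of_tendsto hlim ?_) zero_le
    filter_upwards [Filter.eventually_ge_atTop 0] with r hr
    rw [← rayleigh_Ici_ofReal hc hr, ← h1 hr]
    exact measure_mono fun x hx => by simp_all

variable {X Y : Ω → ℝ≥0∞} {μ : Measure ℝ≥0∞}

theorem measure_le_of_indepFun (hX : Measurable X) (hY : Measurable Y) (hXY : IndepFun X Y P)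
    (hμ : P.map X = μ) : P {ω | X ω ≤ Y ω} = ∫⁻ a, P {ω | a ≤ Y ω} ∂μ := by
  have hprod := (indepFun_iff_map_prod_eq_prod_map_map hX.aemeasurable hY.aemeasurable).1 hXY
  have hp := Measure.isProbabilityMeasure_map (μ := P) hY.aemeasurable
  have hS : MeasurableSet {q : ℝ≥0∞ × ℝ≥0∞ | q.1 ≤ q.2} :=
    measurableSet_le measurable_fst measurable_snd
  have h := Measure.map_apply (hX.prodMk hY) hS (μ := P)
  rw [hprod, Measure.prod_apply hS, hμ] at h
  refine h.symm.trans (lintegral_congr fun a => ?_)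
  exact Measure.map_apply hY measurableSet_Ici

/-- By Fubini, each section of the diagonal at a value of `Y` is a single point, which the law of
`X` does not charge. -/
theorem measure_eq_of_indepFun (hX : Measurable X) (hY : Measurable Y) (hXY : IndepFun X Y P)
    (hμ : ∀ a, P.map X {a} = 0) : P {ω | X ω = Y ω} = 0 := by
  have hprod := (indepFun_iff_map_prod_eq_prod_map_map hX.aemeasurable hY.aemeasurable).1 hXY
  have hp := Measure.isProbabilityMeasure_map (μ := P) hY.aemeasurable
  have hp' := Measure.isProbabilityMeasure_map (μ := P) hX.aemeasurable
  have hS : MeasurableSet {q : ℝ≥0∞ × ℝ≥0∞ | q.1 = q.2} :=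
    measurableSet_eq_fun measurable_fst measurable_snd
  have h := Measure.map_apply (hX.prodMk hY) hS (μ := P)
  rw [hprod, Measure.prod_apply_symm hS] at h
  refine h.symm.trans ?_
  rw [lintegral_eq_zero_iff (measurable_measure_prodMk_right hS)]
  exact .of_forall hμ

end NearestLaw

/-! ### From Palm to stationary probabilities. -/

section Palm

variable {Ω : Type*}

theorem infEDist_flow {flow : Plane → Ω → Ω} {N : Ω → Configuration Plane}
    (h : IsCompatible flow N) (x : Plane) (ω : Ω) :
    Metric.infEDist 0 (N (flow x ω)).pts = Metric.infEDist x (N ω).pts := by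
  rw [h x ω]
  have : {y | y + x ∈ (N ω).pts} = (fun y => y - x) '' (N ω).pts := by
    ext y
    simp [sub_eq_iff_eq_add]
  rw [this]
  simp only [Metric.infEDist, iInf_image, edist_dist, dist_eq_norm, zero_sub, neg_sub]

variable [MeasurableSpace Ω] {P : Measure Ω}
  {flow : Plane → Ω → Ω} {lamb lamu laml mub : ℝ} {Φb Φu Ψb : Ω → Configuration Plane}
  {Ξ : Ω → Configuration (ℝ × ℝ)} {L : ℕ → Ω → ℝ × ℝ} {φ : ℕ → Ω → Configuration ℝ}

/-- No measurability of the events is needed, so this applies to the events on `Xstar`. -/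
theorem palm_mono (N : Ω → Configuration Plane) {A B : Set Ω} (h : A ⊆ B) :
    palm P flow N A ≤ palm P flow N B := by
  refine ENNReal.div_le_div_right (lintegral_mono fun ω => ENNReal.tsum_le_tsum fun x => ?_) _
  exact indicator_le_indicator_of_subset h (fun _ => zero_le) _

namespace IsNetwork

theorem infEDist_Ψb (h : IsNetwork P flow lamb lamu laml mub Φb Φu Ξ L φ Ψb) (x : Plane) (ω : Ω) :
    Metric.infEDist x (Ψb ω).pts = roadDist x (fun i => L i ω) (fun i => φ i ω) := by
  rw [h.pts_Ψb, infEDist_iUnion_roadPoint]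

theorem measurable_infEDist_Φb (h : IsNetwork P flow lamb lamu laml mub Φb Φu Ξ L φ Ψb) :
    Measurable fun ω => Metric.infEDist (0 : Plane) (Φb ω).pts :=
  (measurable_infEDist_pts.of_uncurry_left
    (f := fun (x : Plane) (s : Configuration Plane) => Metric.infEDist x s.pts)).comp
    h.poisson_Φb.measurable

theorem measurable_roads (h : IsNetwork P flow lamb lamu laml mub Φb Φu Ξ L φ Ψb) :
    Measurable fun ω => ((fun i => L i ω), (fun i => φ i ω)) :=
  (measurable_pi_lambda _ h.measurable_L).prodMk
    (measurable_pi_lambda _ fun i => (h.poisson_φ i).measurable)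

theorem measurable_infEDist_Ψb (h : IsNetwork P flow lamb lamu laml mub Φb Φu Ξ L φ Ψb) :
    Measurable fun ω => Metric.infEDist (0 : Plane) (Ψb ω).pts := by
  simp_rw [h.infEDist_Ψb]
  exact (measurable_roadDist_right 0).comp h.measurable_roads

theorem indepFun_infEDist (h : IsNetwork P flow lamb lamu laml mub Φb Φu Ξ L φ Ψb) :
    IndepFun (fun ω => Metric.infEDist (0 : Plane) (Φb ω).pts)
      (fun ω => Metric.infEDist (0 : Plane) (Ψb ω).pts) P := by
  simp_rw [h.infEDist_Ψb]
  exact h.indep_Φb.comp (measurable_infEDist_pts.of_uncurry_left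
    (f := fun (x : Plane) (s : Configuration Plane) => Metric.infEDist x s.pts))
    (measurable_roadDist_right 0)

variable [IsProbabilityMeasure P]

theorem measure_le_infEDist_Ψb (h : IsNetwork P flow lamb lamu laml mub Φb Φu Ξ L φ Ψb)
    (hlaml : 0 ≤ laml) (hmub : 0 ≤ mub) {r : ℝ} (hr : 0 ≤ r) :
    P {ω | ENNReal.ofReal r ≤ Metric.infEDist 0 (Ψb ω).pts} =
      ENNReal.ofReal (Real.exp (-(2 * laml *
        ∫ t in (0 : ℝ)..r, (1 - Real.exp (-2 * mub * √(r ^ 2 - t ^ 2)))))) := by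
  simp_rw [h.infEDist_Ψb]
  exact measure_le_roadDist hlaml hmub h.poisson_Ξ h.measurable_L h.injective_L h.range_L
    h.poisson_φ h.iIndep_φ h.indep_L_φ hr

theorem lintegral_associationDensity (h : IsNetwork P flow lamb lamu laml mub Φb Φu Ξ L φ Ψb)
    (hlamb : 0 < lamb) (hlaml : 0 ≤ laml) (hmub : 0 ≤ mub) :
    P {ω | Metric.infEDist 0 (Φb ω).pts ≤ Metric.infEDist 0 (Ψb ω).pts} =
      ∫⁻ r in Ioi 0, ENNReal.ofReal (associationDensity lamb laml mub r) := by
  have hanti : Antitone fun a => P {ω | a ≤ Metric.infEDist 0 (Ψb ω).pts} :=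
    fun a b hab => measure_mono fun ω hω => hab.trans hω
  rw [measure_le_of_indepFun h.measurable_infEDist_Φb h.measurable_infEDist_Ψb h.indepFun_infEDist
    (map_infEDist_eq_rayleigh hlamb h.poisson_Φb), lintegral_rayleigh _ hanti.measurable]
  refine setLIntegral_congr_fun measurableSet_Ioi fun r hr => ?_
  have hr' : 0 < r := hr
  rw [h.measure_le_infEDist_Ψb hlaml hmub hr'.le, ← ENNReal.ofReal_mul (by positivity),
    associationDensity, mul_assoc, ← Real.exp_add]
  congr 2
  · ring
  · ring_nf

theorem integrableOn_associationDensity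
    (h : IsNetwork P flow lamb lamu laml mub Φb Φu Ξ L φ Ψb)
    (hlamb : 0 < lamb) (hlaml : 0 ≤ laml) (hmub : 0 ≤ mub) :
    IntegrableOn (associationDensity lamb laml mub) (Ioi 0) := by
  have hanti : Antitone fun r : ℝ =>
      P {ω | ENNReal.ofReal r ≤ Metric.infEDist 0 (Ψb ω).pts} :=
    fun a b hab => measure_mono fun ω hω => (ENNReal.ofReal_le_ofReal hab).trans hω
  have hmeas : AEStronglyMeasurable (associationDensity lamb laml mub)
      (volume.restrict (Ioi 0)) := by
    -- The factor with the inner integral is a tail probability of `Rv`, antitone in `r` and thus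
    -- measurable.
    have hm : Measurable fun r : ℝ => 2 * Real.pi * lamb * r *
        (Real.exp (-Real.pi * lamb * r ^ 2) *
          (P {ω | ENNReal.ofReal r ≤ Metric.infEDist 0 (Ψb ω).pts}).toReal) := by
      have := hanti.measurable.ennreal_toReal
      fun_prop
    refine hm.aestronglyMeasurable.congr ?_
    filter_upwards [ae_restrict_mem measurableSet_Ioi] with r hr
    rw [h.measure_le_infEDist_Ψb hlaml hmub (le_of_lt hr),
      ENNReal.toReal_ofReal (Real.exp_nonneg _), associationDensity, ← Real.exp_add]
    rfl
  refine ⟨hmeas, ?_⟩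
  rw [hasFiniteIntegral_iff_ofReal]
  · rw [← h.lintegral_associationDensity hlamb hlaml hmub]
    exact measure_lt_top _ _
  · filter_upwards [ae_restrict_mem measurableSet_Ioi] with r hr
    have : 0 < r := hr
    unfold associationDensity
    positivity

/-- The Palm probability of an event on the distances to the closest base stations, by
independence, is its stationary probability. -/
theorem palm_infEDist (h : IsNetwork P flow lamb lamu laml mub Φb Φu Ξ L φ Ψb) (hlamu : 0 < lamu)
    {T : Set (ℝ≥0∞ × ℝ≥0∞)} (hT : MeasurableSet T) :
    palm P flow Φu {ω | (Metric.infEDist 0 (Φb ω).pts, Metric.infEDist 0 (Ψb ω).pts) ∈ T} =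
      P {ω | (Metric.infEDist 0 (Φb ω).pts, Metric.infEDist 0 (Ψb ω).pts) ∈ T} := by
  set A := {ω | (Metric.infEDist 0 (Φb ω).pts, Metric.infEDist 0 (Ψb ω).pts) ∈ T} with hA
  have hAm : MeasurableSet A := (h.measurable_infEDist_Φb.prodMk h.measurable_infEDist_Ψb) hT
  -- `f` is the event as observed from a point of the plane. The vehicular stations enter through
  -- roads and positions because `indep_Φu` is stated for these.
  let f : (Configuration Plane × (ℕ → ℝ × ℝ) × (ℕ → Configuration ℝ)) × Plane → ℝ≥0∞ :=
    fun q => T.indicator 1 (Metric.infEDist q.2 q.1.1.pts, roadDist q.2 q.1.2.1 q.1.2.2)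
  have hf : Measurable f := by
    have h1 : Measurable fun q : (Configuration Plane × (ℕ → ℝ × ℝ) × (ℕ → Configuration ℝ)) ×
        Plane => (q.2, q.1.1) := by fun_prop
    have h2 : Measurable fun q : (Configuration Plane × (ℕ → ℝ × ℝ) × (ℕ → Configuration ℝ)) ×
        Plane => (q.2, q.1.2) := by fun_prop
    have h3 : Measurable (T.indicator (1 : ℝ≥0∞ × ℝ≥0∞ → ℝ≥0∞)) := measurable_one.indicator hT
    exact h3.comp ((measurable_infEDist_pts.comp h1).prodMk (measurable_roadDist.comp h2))
  let Y : Ω → Configuration Plane × (ℕ → ℝ × ℝ) × (ℕ → Configuration ℝ) :=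
    fun ω => (Φb ω, (fun i => L i ω), (fun i => φ i ω))
  have hfY (x : Plane) (ω : Ω) : f (Y ω, x) = A.indicator 1 (flow x ω) := by
    change T.indicator 1
      (Metric.infEDist x (Φb ω).pts, roadDist x (fun i => L i ω) (fun i => φ i ω)) = _
    rw [← h.infEDist_Ψb, ← infEDist_flow h.compatible_Φb, ← infEDist_flow h.compatible_Ψb]
    rfl
  have hstat (x : Plane) : ∫⁻ ω, f (Y ω, x) ∂P = P A := by
    simp_rw [hfY]
    rw [← lintegral_indicator_one hAm]
    exact (h.stationary.measurePreserving x).lintegral_comp (measurable_one.indicator hAm)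
  have hvol : (ENNReal.ofReal lamu • volume) unitSquare = ENNReal.ofReal lamu := by
    simp [volume_unitSquare]
  have hsum (ω : Ω) : ∑' x : ↥((Φu ω).pts ∩ unitSquare), A.indicator (1 : Ω → ℝ≥0∞) (flow x ω) =
      ∫⁻ x in unitSquare, f (Y ω, x) ∂(Φu ω).measure := by
    rw [Configuration.measure, Measure.restrict_restrict measurableSet_unitSquare, inter_comm,
      lintegral_countable _ ((Φu ω).countable_pts.mono inter_subset_right)]
    simp [hfY]
  have hint : intensity P Φu = ENNReal.ofReal lamu := by
    rw [intensity, h.poisson_Φu.lintegral_count measurableSet_unitSquare (by simp [hvol]), hvol]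
  have hcampbell := h.poisson_Φu.campbell (Y := Y) (h.poisson_Φb.measurable.prodMk h.measurable_roads)
    h.indep_Φu measurableSet_unitSquare (by simp [hvol]) hf
  simp_rw [hstat] at hcampbell
  rw [palm, hint]
  simp_rw [hsum]
  rw [hcampbell, setLIntegral_const, hvol,
    ENNReal.mul_div_cancel_right (by simpa using hlamu) (by simp)]

end IsNetwork

end Palm

end CoxNetwork

/-! ### The association probabilities. -/

theorem proposition1 {Ω : Type*} [MeasurableSpace Ω] (P : Measure Ω) [IsProbabilityMeasure P]
    (flow : CoxNetwork.Plane → Ω → Ω) (lamb lamu laml mub : ℝ)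
    (hlamb : 0 < lamb) (hlamu : 0 < lamu) (hlaml : 0 < laml) (hmub : 0 < mub)
    (Φb Φu Ψb : Ω → CoxNetwork.Configuration CoxNetwork.Plane)
    (Ξ : Ω → CoxNetwork.Configuration (ℝ × ℝ)) (L : ℕ → Ω → ℝ × ℝ)
    (φ : ℕ → Ω → CoxNetwork.Configuration ℝ)
    (hnet : CoxNetwork.IsNetwork P flow lamb lamu laml mub Φb Φu Ξ L φ Ψb)
    (Xstar : Ω → CoxNetwork.Plane)
    (hXstar : ∀ ω, ((Φb ω).pts ∪ (Ψb ω).pts).Nonempty →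
      CoxNetwork.IsNearest ((Φb ω).pts ∪ (Ψb ω).pts) (Xstar ω)) :
    IntegrableOn (CoxNetwork.associationDensity lamb laml mub) (Ioi 0) ∧
    CoxNetwork.palm P flow Φu {ω | Xstar ω ∈ (Φb ω).pts} =
      ENNReal.ofReal (∫ r in Ioi (0 : ℝ), CoxNetwork.associationDensity lamb laml mub r) ∧
    CoxNetwork.palm P flow Φu {ω | Xstar ω ∈ (Ψb ω).pts} =
      ENNReal.ofReal (1 - ∫ r in Ioi (0 : ℝ), CoxNetwork.associationDensity lamb laml mub r) := by
  set Rb : Ω → ℝ≥0∞ := fun ω => Metric.infEDist 0 (Φb ω).pts with hRb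
  set Rv : Ω → ℝ≥0∞ := fun ω => Metric.infEDist 0 (Ψb ω).pts with hRv
  have hRbm : Measurable Rb := hnet.measurable_infEDist_Φb
  have hRvm : Measurable Rv := hnet.measurable_infEDist_Ψb
  have hint := hnet.integrableOn_associationDensity hlamb hlaml.le hmub.le
  have hnonneg : 0 ≤ᵐ[volume.restrict (Ioi 0)] CoxNetwork.associationDensity lamb laml mub := by
    filter_upwards [ae_restrict_mem measurableSet_Ioi] with r hr
    have : 0 < r := hr
    simp only [CoxNetwork.associationDensity, Pi.zero_apply]
    positivity
  have hle : P {ω | Rb ω ≤ Rv ω} =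
      ENNReal.ofReal (∫ r in Ioi (0 : ℝ), CoxNetwork.associationDensity lamb laml mub r) := by
    rw [ofReal_integral_eq_lintegral_ofReal hint hnonneg]
    exact hnet.lintegral_associationDensity hlamb hlaml.le hmub.le
  have htie : P {ω | Rb ω = Rv ω} = 0 :=
    CoxNetwork.measure_eq_of_indepFun hRbm hRvm hnet.indepFun_infEDist fun a => by
      rw [CoxNetwork.map_infEDist_eq_rayleigh hlamb hnet.poisson_Φb,
        CoxNetwork.rayleigh_singleton]
  have hlt : P {ω | Rb ω < Rv ω} = P {ω | Rb ω ≤ Rv ω} := by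
    refine measure_congr ?_
    have : ∀ᵐ ω ∂P, Rb ω ≠ Rv ω := measure_eq_zero_iff_ae_notMem.1 htie
    filter_upwards [this] with ω hω
    exact propext ⟨le_of_lt, fun h => lt_of_le_of_ne h hω⟩
  have hlt' : P {ω | Rv ω < Rb ω} = P {ω | Rv ω ≤ Rb ω} := by
    refine measure_congr ?_
    have : ∀ᵐ ω ∂P, Rb ω ≠ Rv ω := measure_eq_zero_iff_ae_notMem.1 htie
    filter_upwards [this] with ω hω
    exact propext ⟨le_of_lt, fun h => lt_of_le_of_ne h hω.symm⟩
  have hcompl : P {ω | Rv ω < Rb ω} =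
      ENNReal.ofReal (1 - ∫ r in Ioi (0 : ℝ), CoxNetwork.associationDensity lamb laml mub r) := by
    rw [ENNReal.ofReal_sub _ (integral_nonneg_of_ae hnonneg), ENNReal.ofReal_one, ← hle,
      ← prob_compl_eq_one_sub (measurableSet_le hRbm hRvm)]
    congr 1
    ext ω
    simp
  have hnear {S S' : Set CoxNetwork.Plane} {x : CoxNetwork.Plane} (hx : x ∈ S)
      (hn : ∀ y ∈ S', ‖x‖ ≤ ‖y‖) : Metric.infEDist 0 S ≤ Metric.infEDist 0 S' := by
    refine (Metric.infEDist_le_edist_of_mem hx).trans (Metric.le_infEDist.2 fun y hy => ?_)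
    simpa [edist_dist] using ENNReal.ofReal_le_ofReal (hn y hy)
  -- The distance to the empty set is `⊤`, so a strict comparison supplies the station needed to use
  -- `hXstar`.
  have hne {S : Set CoxNetwork.Plane} {a : ℝ≥0∞} (h : Metric.infEDist 0 S < a) : S.Nonempty := by
    by_contra! hS
    simp [hS] at h
  -- A nearest station that was vehicular would force `Rv ≤ Rb`. With the next inclusion this
  -- encloses the event between two that differ by ties only.
  have hb1 : {ω | Rb ω < Rv ω} ⊆ {ω | Xstar ω ∈ (Φb ω).pts} := fun ω hω => by
    have h := hXstar ω ((hne hω).mono subset_union_left)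
    exact h.1.resolve_right fun hv =>
      hω.not_ge (hnear hv fun y hy => h.2 y (mem_union_left _ hy))
  have hb2 : {ω | Xstar ω ∈ (Φb ω).pts} ⊆ {ω | Rb ω ≤ Rv ω} := fun ω hω =>
    hnear hω fun y hy => (hXstar ω ⟨_, mem_union_left _ hω⟩).2 y (mem_union_right _ hy)
  have hv1 : {ω | Rv ω < Rb ω} ⊆ {ω | Xstar ω ∈ (Ψb ω).pts} := fun ω hω => by
    have h := hXstar ω ((hne hω).mono subset_union_right)
    exact h.1.resolve_left fun hv =>
      hω.not_ge (hnear hv fun y hy => h.2 y (mem_union_right _ hy))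
  have hv2 : {ω | Xstar ω ∈ (Ψb ω).pts} ⊆ {ω | Rv ω ≤ Rb ω} := fun ω hω =>
    hnear hω fun y hy => (hXstar ω ⟨_, mem_union_right _ hω⟩).2 y (mem_union_left _ hy)
  have hpalm (T : Set (ℝ≥0∞ × ℝ≥0∞)) (hT : MeasurableSet T) :
      CoxNetwork.palm P flow Φu {ω | (Rb ω, Rv ω) ∈ T} = P {ω | (Rb ω, Rv ω) ∈ T} :=
    hnet.palm_infEDist hlamu hT
  refine ⟨hint, ?_, ?_⟩
  · rw [← hle]
    refine le_antisymm ((CoxNetwork.palm_mono Φu hb2).trans_eq ?_)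
      ((Eq.trans_le ?_ (CoxNetwork.palm_mono Φu hb1)))
    · exact hpalm {q | q.1 ≤ q.2} (measurableSet_le measurable_fst measurable_snd)
    · rw [← hlt]
      exact (hpalm {q | q.1 < q.2} (measurableSet_lt measurable_fst measurable_snd)).symm
  · rw [← hcompl]
    refine le_antisymm ((CoxNetwork.palm_mono Φu hv2).trans_eq ?_)
      ((Eq.trans_le ?_ (CoxNetwork.palm_mono Φu hv1)))
    · rw [hlt']
      exact hpalm {q | q.2 ≤ q.1} (measurableSet_le measurable_snd measurable_fst)
    · exact (hpalm {q | q.2 < q.1} (measurableSet_lt measurable_snd measurable_fst)).symm
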